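/- Let $\mathcal{H}$ be a separable complex Hilbert space and let $\mathcal{A},\mathcal{B}\subseteq B(\mathcal{H})$ be two von Neumann algebras of type III acting on $\mathcal{H}$; that is, neither contains a nonzero finite projection, where a projection $e\in\mathcal{A}$ is finite if the only projection $f\in\mathcal{A}$ with $f\le e$ and $e=v^*v$, $f=vv^*$ for some $v\in\mathcal{A}$ is $f=e$. (No inclusion between $\mathcal{A}$ and $\mathcal{B}$ is assumed.) A vector $\xi\in\mathcal{H}$ is cyclic for $\mathcal{A}$ if $\mathcal{A}\xi=\{a\xi : a\in\mathcal{A}\}$ is norm-dense in $\mathcal{H}$, and separating for $\mathcal{A}$ if $a\in\mathcal{A}$ and $a\xi=0$ imply $a=0$; likewise for $\mathcal{B}$. Then the set of vectors that are cyclic and separating for both $\mathcal{A}$ and $\mathcal{B}$ is a dense $G_\delta$ subset of $\mathcal{H}$ (a countable intersection of open sets) in the norm topology. -/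

import Mathlib

namespace VonNeumannAlgebra

variable {H : Type*} [NormedAddCommGroup H] [InnerProductSpace ℂ H] [CompleteSpace H]

/-- Murray–von Neumann equivalence of `e` and `f` relative to `A`: some `v ∈ A` satisfies
`v⋆ v = e` and `v v⋆ = f`. -/
def MvNEquiv (A : VonNeumannAlgebra H) (e f : H →L[ℂ] H) : Prop :=
  ∃ v ∈ A, star v * v = e ∧ v * star v = f

/-- A projection `e` of `A` is finite if it is not equivalent, relative to `A`, to a proper
subprojection of itself that lies in `A`. -/
def IsFiniteProjection (A : VonNeumannAlgebra H) (e : H →L[ℂ] H) : Prop :=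
  e ∈ A ∧ IsStarProjection e ∧
    ∀ f ∈ A, IsStarProjection f → f ≤ e → A.MvNEquiv e f → f = e

/-- `A` is of type III if its only finite projection is zero. -/
def IsTypeIII (A : VonNeumannAlgebra H) : Prop :=
  ∀ e : H →L[ℂ] H, A.IsFiniteProjection e → e = 0

/-- `ξ` is cyclic for `A` if `A ξ` is dense in the Hilbert space. -/
def IsCyclicVector (A : VonNeumannAlgebra H) (ξ : H) : Prop :=
  Dense {η : H | ∃ a ∈ A, a ξ = η}

/-- `ξ` is separating for `A` if the only element of `A` annihilating `ξ` is zero. -/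
def IsSeparatingVector (A : VonNeumannAlgebra H) (ξ : H) : Prop :=
  ∀ a ∈ A, a ξ = 0 → a = 0

/-- The set of vectors that are cyclic and separating for `A`. -/
def cyclicSeparatingVectors (A : VonNeumannAlgebra H) : Set H :=
  {ξ | A.IsCyclicVector ξ ∧ A.IsSeparatingVector ξ}

end VonNeumannAlgebra

namespace VonNeumannAlgebra

open Filter Topology

variable {H : Type*} [NormedAddCommGroup H] [InnerProductSpace ℂ H] [CompleteSpace H]

/-! ### Cyclic and separating vectors -/

/-! Separating for `A` means cyclic for the commutant `A'`, and the cyclic vectors of any von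
Neumann algebra form a Gδ. By Baire it is enough, for each type III algebra separately, to show that
every set `approximants` of `A` and of `A'` is dense.

Type III supplies infinitely many orthogonal copies `u n` of one projection under a given `e`. By
Bessel, `star (u n) ζ → 0`, so a far-out finite block of copies is a corner of `A` in which `ζ` is
almost absent. `IsTypeIII.exists_corner` turns this into a vector `v` in the corner and `b ∈ A` with
`b v` near any prescribed `η`. For `A`, replace the corner part of `ζ` by a small multiple of `v`.
For `A'`, replace `ζ` by `w ζ` with `w = 1 - g + b` in `A`, which commutes with `A'`. -/

theorem _root_.ContinuousLinearMap.apply_mem_topologicalClosure {E : Type*}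
    [NormedAddCommGroup E] [NormedSpace ℂ E] (b : E →L[ℂ] E) {K : Submodule ℂ E}
    (h : ∀ x ∈ K, b x ∈ K) {x : E} (hx : x ∈ K.topologicalClosure) :
    b x ∈ K.topologicalClosure :=
  map_mem_closure b.continuous hx h

/-- The projection onto a subspace that is invariant under the commutant lies in the algebra. -/
theorem starProjection_mem (A : VonNeumannAlgebra H) (K : Submodule ℂ H)
    [K.HasOrthogonalProjection] (h : ∀ b ∈ A.commutant, ∀ x ∈ K, b x ∈ K) :
    K.starProjection ∈ A := by
  rw [IsStarProjection.mem_iff isStarProjection_starProjection]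
  intro b hb
  rw [Submodule.range_starProjection]
  exact fun x hx => h b hb x hx

theorem apply_comm_of_mem_commutant {A : VonNeumannAlgebra H} {a b : H →L[ℂ] H} (ha : a ∈ A)
    (hb : b ∈ A.commutant) (x : H) : a (b x) = b (a x) :=
  DFunLike.congr_fun (mem_commutant_iff.1 hb a ha) x

theorem smul_mem' {A : VonNeumannAlgebra H} (c : ℂ) {a : H →L[ℂ] H} (ha : a ∈ A) : c • a ∈ A :=
  A.toStarSubalgebra.smul_mem ha c

/-- The orbit of a vector under the algebra, as a subspace. -/
def orbit (A : VonNeumannAlgebra H) (ξ : H) : Submodule ℂ H where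
  carrier := {η | ∃ a ∈ A, a ξ = η}
  add_mem' := by
    rintro _ _ ⟨a, ha, rfl⟩ ⟨b, hb, rfl⟩
    exact ⟨a + b, add_mem ha hb, rfl⟩
  zero_mem' := ⟨0, zero_mem A, rfl⟩
  smul_mem' := by
    rintro c _ ⟨a, ha, rfl⟩
    exact ⟨c • a, smul_mem' c ha, rfl⟩

theorem apply_mem_orbit {A : VonNeumannAlgebra H} {b : H →L[ℂ] H} (hb : b ∈ A) {ξ x : H}
    (hx : x ∈ A.orbit ξ) : b x ∈ A.orbit ξ := by
  obtain ⟨a, ha, rfl⟩ := hx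
  exact ⟨b * a, mul_mem hb ha, rfl⟩

theorem self_mem_orbit (A : VonNeumannAlgebra H) (ξ : H) : ξ ∈ A.orbit ξ :=
  ⟨1, one_mem A, rfl⟩

theorem starProjection_closure_orbit_mem (A : VonNeumannAlgebra H) (ξ : H) :
    (A.commutant.orbit ξ).topologicalClosure.starProjection ∈ A :=
  A.starProjection_mem _ fun b hb _ hx =>
    b.apply_mem_topologicalClosure (fun _ h => apply_mem_orbit hb h) hx

/-- A vector is separating for `A` iff it is cyclic for the commutant of `A`. -/
theorem isSeparatingVector_iff (A : VonNeumannAlgebra H) (ξ : H) :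
    A.IsSeparatingVector ξ ↔ A.commutant.IsCyclicVector ξ := by
  constructor
  · intro h
    -- The projection onto `K` lies in `A` and its complement annihilates `ξ`, so that complement is
    -- zero.
    set K := (A.commutant.orbit ξ).topologicalClosure with hK
    have hmem : 1 - K.starProjection ∈ A :=
      sub_mem (one_mem A) (starProjection_closure_orbit_mem A ξ)
    have hξ : ξ ∈ K := Submodule.le_topologicalClosure _ (self_mem_orbit _ _)
    have h0 := h _ hmem (by
      simp [Submodule.starProjection_eq_self_iff.2 hξ])
    intro x
    have hx : K.starProjection x = x := by
      have : x - K.starProjection x = 0 := DFunLike.congr_fun h0 x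
      exact (sub_eq_zero.1 this).symm
    exact Submodule.starProjection_eq_self_iff.1 hx
  · intro h a ha haξ
    ext x
    refine congrFun (Continuous.ext_on h a.continuous continuous_const (g := fun _ => (0 : H)) ?_) x
    rintro _ ⟨b, hb, rfl⟩
    change a (b ξ) = 0
    rw [apply_comm_of_mem_commutant ha hb, haξ, map_zero]

/-- The vectors whose orbit comes within `ε` of `η`. -/
def approximants (A : VonNeumannAlgebra H) (η : H) (ε : ℝ) : Set H :=
  {ξ | ∃ a ∈ A, ‖a ξ - η‖ < ε}

theorem isOpen_approximants (A : VonNeumannAlgebra H) (η : H) (ε : ℝ) :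
    IsOpen (A.approximants η ε) := by
  have : A.approximants η ε = ⋃ a ∈ A, {ξ | ‖a ξ - η‖ < ε} := by
    ext ξ
    simp [approximants]
  rw [this]
  exact isOpen_biUnion fun a _ => isOpen_lt (by fun_prop) continuous_const

/-- Separability makes countably many targets and tolerances suffice, so Baire applies to the open
sets on the right. -/
theorem setOf_isCyclicVector_eq [TopologicalSpace.SeparableSpace H] (A : VonNeumannAlgebra H) :
    {ξ | A.IsCyclicVector ξ} = ⋂ i : ℕ × ℕ,
      A.approximants (TopologicalSpace.denseSeq H i.1) (1 / ((i.2 : ℝ) + 1)) := by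
  ext ξ
  simp only [Set.mem_ofPred_eq, Set.mem_iInter]
  constructor
  · rintro h ⟨n, k⟩
    obtain ⟨_, hd, a, ha, rfl⟩ := Metric.dense_iff.1 h (TopologicalSpace.denseSeq H n)
      (1 / ((k : ℝ) + 1)) Nat.one_div_pos_of_nat
    exact ⟨a, ha, by rw [← dist_eq_norm]; exact hd⟩
  · intro h
    refine Metric.dense_iff.2 fun x r hr => ?_
    obtain ⟨k, hk⟩ := exists_nat_one_div_lt (half_pos hr)
    obtain ⟨n, hn⟩ := (TopologicalSpace.denseRange_denseSeq H).exists_dist_lt x (half_pos hr)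
    obtain ⟨a, ha, hd⟩ := h (n, k)
    refine ⟨a ξ, ?_, a, ha, rfl⟩
    rw [← dist_eq_norm] at hd
    rw [Metric.mem_ball]
    have := dist_triangle_right (a ξ) x (TopologicalSpace.denseSeq H n)
    dsimp only at hd
    linarith

theorem isGδ_setOf_isCyclicVector [TopologicalSpace.SeparableSpace H]
    (A : VonNeumannAlgebra H) : IsGδ {ξ | A.IsCyclicVector ξ} := by
  rw [setOf_isCyclicVector_eq]
  exact IsGδ.iInter fun i => (isOpen_approximants A _ _).isGδ

theorem dense_setOf_isCyclicVector [TopologicalSpace.SeparableSpace H]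
    (A : VonNeumannAlgebra H) (h : ∀ η, ∀ ε > 0, Dense (A.approximants η ε)) :
    Dense {ξ | A.IsCyclicVector ξ} := by
  rw [setOf_isCyclicVector_eq]
  exact dense_iInter_of_isOpen (fun i => isOpen_approximants A _ _)
    fun i => h _ _ Nat.one_div_pos_of_nat

/-! ### Sequences of orthogonal copies of a projection -/

/-- The `u n` are partial isometries in `A` with a common initial projection `star (u 0) * u 0`
and pairwise orthogonal ranges, all contained in the range of `e`. -/
structure OrthogonalCopies (A : VonNeumannAlgebra H) (e : H →L[ℂ] H) (u : ℕ → H →L[ℂ] H) :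
    Prop where
  mem : ∀ n, u n ∈ A
  left_mul : ∀ n, e * u n = u n
  orthogonal : ∀ m n, m ≠ n → star (u m) * u n = 0
  star_mul_self : ∀ n, star (u n) * u n = star (u 0) * u 0
  mul_initial : ∀ n, u n * (star (u 0) * u 0) = u n

/-- In a type III algebra every nonzero projection contains infinitely many orthogonal copies of
some nonzero projection. -/
theorem IsTypeIII.exists_orthogonalCopies {A : VonNeumannAlgebra H} (hA : A.IsTypeIII)
    {e : H →L[ℂ] H} (he : e ∈ A) (hp : IsStarProjection e) (h0 : e ≠ 0) :
    ∃ u, A.OrthogonalCopies e u ∧ u 0 ≠ 0 := by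
  have hinf : ¬ A.IsFiniteProjection e := fun h => h0 (hA e h)
  simp only [IsFiniteProjection, not_and, not_forall] at hinf
  obtain ⟨f, hf, hfp, hle, ⟨v, hv, hve, hvf⟩, hne⟩ := hinf he hp
  have hef : e * f = f := (hfp.le_iff_mul_eq_right hp).1 hle
  have hee : e * e = e := hp.isIdempotentElem
  have hff : f * f = f := hfp.isIdempotentElem
  have hes : star e = e := hp.isSelfAdjoint
  have hfs : star f = f := hfp.isSelfAdjoint
  have hfe : f * e = f := by
    have := congrArg star hef
    rwa [star_mul, hes, hfs] at this
  have hve' : v * e = v := by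
    have : star (v * (1 - e)) * (v * (1 - e)) = 0 := by
      calc star (v * (1 - e)) * (v * (1 - e)) = (1 - e) * (star v * v) * (1 - e) := by
            rw [star_mul, star_sub, star_one, hes]; noncomm_ring
        _ = 0 := by rw [hve, mul_assoc, hp.mul_one_sub_self, mul_zero]
    have := CStarRing.star_mul_self_eq_zero_iff _ |>.1 this
    rw [mul_sub, mul_one, sub_eq_zero] at this
    exact this.symm
  have hfv : f * v = v := by rw [← hvf, mul_assoc, hve, hve']
  have hev : e * v = v := by rw [← hfv, ← mul_assoc, hef]
  have hpv : (e - f) * v = 0 := by rw [sub_mul, hev, hfv, sub_self]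
  have hpp : (e - f) * (e - f) = e - f := by
    rw [mul_sub, sub_mul, sub_mul, hee, hfe, hef, hff]; abel
  have hps : star (e - f) = e - f := by rw [star_sub, hes, hfs]
  have hep : e * (e - f) = e - f := by rw [mul_sub, hee, hef]
  have hpow : ∀ n x, e * x = x → e * (v ^ n * x) = v ^ n * x := by
    intro n x hx
    cases n with
    | zero => simpa using hx
    | succ n => rw [pow_succ', mul_assoc, ← mul_assoc, hev]
  have hcancel : ∀ n x, e * x = x → star (v ^ n) * (v ^ n * x) = x := by
    intro n
    induction n with
    | zero => intro x _; simp
    | succ n ih =>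
      intro x hx
      calc star (v ^ (n + 1)) * (v ^ (n + 1) * x)
          = star (v ^ n) * ((star v * v) * (v ^ n * x)) := by
            rw [pow_succ', star_mul]; noncomm_ring
        _ = x := by rw [hve, hpow n x hx, ih x hx]
  -- As in the Wold decomposition, `e - f` is a wandering projection: `v` acts isometrically on the
  -- range of `e` and maps into that of `f`, so the powers of `v` carry `e - f` to orthogonal
  -- copies.
  have horth : ∀ m n, m < n →
      star (v ^ m * (e - f)) * (v ^ n * (e - f)) = 0 := by
    intro m n hmn
    obtain ⟨k, rfl⟩ := Nat.exists_eq_add_of_lt hmn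
    have h1 : e * (v ^ (k + 1) * (e - f)) = v ^ (k + 1) * (e - f) := hpow _ _ hep
    calc star (v ^ m * (e - f)) * (v ^ (m + k + 1) * (e - f))
        = (e - f) * (star (v ^ m) * (v ^ m * (v ^ (k + 1) * (e - f)))) := by
          rw [star_mul, hps, add_assoc, pow_add]; noncomm_ring
      _ = 0 := by
          rw [hcancel m _ h1, pow_succ', ← mul_assoc, ← mul_assoc, hpv, zero_mul, zero_mul]
  have hself : ∀ n, star (v ^ n * (e - f)) * (v ^ n * (e - f)) = e - f := by
    intro n
    rw [star_mul, hps, mul_assoc, hcancel n _ hep, hpp]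
  have hinit : star (v ^ 0 * (e - f)) * (v ^ 0 * (e - f)) = e - f := hself 0
  refine ⟨fun n => v ^ n * (e - f), ⟨?_, ?_, ?_, ?_, ?_⟩, ?_⟩
  · exact fun n => mul_mem (pow_mem hv n) (sub_mem he hf)
  · exact fun n => hpow n _ hep
  · intro m n hmn
    rcases lt_or_gt_of_ne hmn with h | h
    · exact horth m n h
    · have := congrArg star (horth n m h)
      rwa [star_mul, star_star, star_zero] at this
  · intro n
    rw [hself, hself]
  · intro n
    rw [hinit, mul_assoc, hpp]
  · simpa [sub_eq_zero] using Ne.symm hne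

namespace OrthogonalCopies

variable {A : VonNeumannAlgebra H} {e : H →L[ℂ] H} {u : ℕ → H →L[ℂ] H}

theorem zero (A : VonNeumannAlgebra H) (e : H →L[ℂ] H) : A.OrthogonalCopies e fun _ => 0 :=
  ⟨fun _ => zero_mem A, by simp, by simp, by simp, by simp⟩

theorem initial_mem (h : A.OrthogonalCopies e u) : star (u 0) * u 0 ∈ A :=
  mul_mem (star_mem (h.mem 0)) (h.mem 0)

theorem norm_le_one (h : A.OrthogonalCopies e u) (n : ℕ) : ‖u n‖ ≤ 1 := by
  have hp : IsStarProjection (star (u 0) * u 0) :=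
    ⟨by rw [IsIdempotentElem, mul_assoc, h.mul_initial], .star_mul_self _⟩
  have := hp.norm_le
  rw [← h.star_mul_self n, CStarRing.norm_star_mul_self] at this
  nlinarith [norm_nonneg (u n)]

theorem mono {e' : H →L[ℂ] H} (h : A.OrthogonalCopies e' u) (he : e * e' = e') :
    A.OrthogonalCopies e u :=
  { h with left_mul := fun n => by rw [← h.left_mul n, ← mul_assoc, he] }

theorem star_mul_apply (h : A.OrthogonalCopies e u) (m n : ℕ) (x : H) :
    star (u m) (u n x) = if m = n then (star (u 0) * u 0) x else 0 := by
  split_ifs with hmn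
  · subst hmn
    exact DFunLike.congr_fun (h.star_mul_self m) x
  · exact DFunLike.congr_fun (h.orthogonal m n hmn) x

/-- Bessel's inequality: the range projections `u n * star (u n)` are orthogonal, so their sum `q`
is a projection, and the left side is `⟪x, q x⟫`. -/
theorem sum_sq_norm_star_apply_le (h : A.OrthogonalCopies e u) (x : H) (s : Finset ℕ) :
    ∑ n ∈ s, ‖star (u n) x‖ ^ 2 ≤ ‖x‖ ^ 2 := by
  set q : H →L[ℂ] H := ∑ n ∈ s, u n * star (u n) with hq
  have hqp : IsStarProjection q := by
    refine ⟨?_, ?_⟩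
    · change q * q = q
      simp only [hq, Finset.sum_mul_sum]
      refine Finset.sum_congr rfl fun m hm => ?_
      rw [Finset.sum_eq_single m]
      · rw [mul_assoc, ← mul_assoc (star (u m)), h.star_mul_self, ← mul_assoc, h.mul_initial]
      · intro n _ hn
        rw [mul_assoc, ← mul_assoc (star (u m)), h.orthogonal m n hn.symm, zero_mul, mul_zero]
      · exact fun hm' => absurd hm hm'
    · simp [IsSelfAdjoint, hq, star_sum]
  have hnorm : ‖q x‖ ≤ ‖x‖ := by
    simpa using (q.le_opNorm x).trans
      (mul_le_mul_of_nonneg_right (IsStarProjection.norm_le q hqp) (norm_nonneg x))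
  have hsum : (∑ n ∈ s, ‖star (u n) x‖ ^ 2 : ℝ) = RCLike.re (inner ℂ x (q x)) := by
    simp only [hq, sum_apply, inner_sum, map_sum]
    refine Finset.sum_congr rfl fun n _ => ?_
    rw [mul_apply_eq_comp, ← ContinuousLinearMap.adjoint_inner_left,
      ← ContinuousLinearMap.star_eq_adjoint, ← inner_self_eq_norm_sq (𝕜 := ℂ)]
  rw [hsum, sq]
  exact (re_inner_le_norm _ _).trans (mul_le_mul_of_nonneg_left hnorm (norm_nonneg _))

theorem tendsto_star_apply (h : A.OrthogonalCopies e u) (x : H) :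
    Tendsto (fun n => star (u n) x) atTop (𝓝 0) := by
  have hs : Summable fun n => ‖star (u n) x‖ ^ 2 :=
    summable_of_sum_le (fun _ => sq_nonneg _) (h.sum_sq_norm_star_apply_le x)
  rw [tendsto_zero_iff_norm_tendsto_zero]
  have := hs.tendsto_atTop_zero.sqrt
  simpa using this

end OrthogonalCopies

/-! ### Central supports -/

/-- The closed subspace spanned by `A p H`: the range of the central support of `p`. -/
def supportSpace (A : VonNeumannAlgebra H) (p : H →L[ℂ] H) : Submodule ℂ H :=
  (Submodule.span ℂ {y | ∃ a ∈ A, ∃ x, a (p x) = y}).topologicalClosure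

section supportSpace

variable {A : VonNeumannAlgebra H} {p : H →L[ℂ] H}

instance : (A.supportSpace p).HasOrthogonalProjection := by
  unfold supportSpace; infer_instance

theorem apply_apply_mem_supportSpace {a : H →L[ℂ] H} (ha : a ∈ A) (x : H) :
    a (p x) ∈ A.supportSpace p :=
  Submodule.le_topologicalClosure _ (Submodule.subset_span ⟨a, ha, x, rfl⟩)

theorem apply_mem_supportSpace (x : H) : p x ∈ A.supportSpace p :=
  apply_apply_mem_supportSpace (one_mem A) x

theorem supportSpace_le {K : Submodule ℂ H} (hK : IsClosed (K : Set H))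
    (h : ∀ a ∈ A, ∀ x, a (p x) ∈ K) : A.supportSpace p ≤ K := by
  refine Submodule.topologicalClosure_minimal _ (Submodule.span_le.2 ?_) hK
  rintro _ ⟨a, ha, x, rfl⟩
  exact h a ha x

theorem isClosed_supportSpace : IsClosed (A.supportSpace p : Set H) :=
  Submodule.isClosed_topologicalClosure _

theorem mem_supportSpace_of_mem {b : H →L[ℂ] H} (hb : b ∈ A) {x : H}
    (hx : x ∈ A.supportSpace p) : b x ∈ A.supportSpace p := by
  have : A.supportSpace p ≤ (A.supportSpace p).comap (b : H →ₗ[ℂ] H) :=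
    supportSpace_le (isClosed_supportSpace.preimage b.continuous) fun a ha x =>
      apply_apply_mem_supportSpace (mul_mem hb ha) x
  exact this hx

theorem mem_supportSpace_of_mem_commutant (hp : p ∈ A) {b : H →L[ℂ] H} (hb : b ∈ A.commutant)
    {x : H} (hx : x ∈ A.supportSpace p) : b x ∈ A.supportSpace p := by
  have : A.supportSpace p ≤ (A.supportSpace p).comap (b : H →ₗ[ℂ] H) :=
    supportSpace_le (isClosed_supportSpace.preimage b.continuous) fun a ha x => by
      change b (a (p x)) ∈ A.supportSpace p
      rw [← apply_comm_of_mem_commutant ha hb, ← apply_comm_of_mem_commutant hp hb]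
      exact apply_apply_mem_supportSpace ha _
  exact this hx

theorem starProjection_supportSpace_mem (hp : p ∈ A) : (A.supportSpace p).starProjection ∈ A :=
  A.starProjection_mem _ fun _ hb _ hx => mem_supportSpace_of_mem_commutant hp hb hx

/-- With the preceding membership in `A`, this makes the projection central when `p ∈ A`. -/
theorem starProjection_supportSpace_mem_commutant :
    (A.supportSpace p).starProjection ∈ A.commutant :=
  A.commutant.starProjection_mem _ fun b hb _ hx =>
    mem_supportSpace_of_mem (by simpa using hb) hx

theorem starProjection_supportSpace_mul : (A.supportSpace p).starProjection * p = p := by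
  ext x
  exact Submodule.starProjection_eq_self_iff.2 (apply_mem_supportSpace x)

end supportSpace

/-- Two sequences of copies under `e` can be amalgamated, along the central support of the first. -/
theorem OrthogonalCopies.exists_supportSpace_le {A : VonNeumannAlgebra H} {e : H →L[ℂ] H}
    {u v : ℕ → H →L[ℂ] H} (hu : A.OrthogonalCopies e u) (hv : A.OrthogonalCopies e v) :
    ∃ w, A.OrthogonalCopies e w ∧
      A.supportSpace (star (u 0) * u 0) ≤ A.supportSpace (star (w 0) * w 0) ∧
      A.supportSpace (star (v 0) * v 0) ≤ A.supportSpace (star (w 0) * w 0) := by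
  set p := star (u 0) * u 0 with hp
  set q := star (v 0) * v 0 with hq
  set z := (A.supportSpace p).starProjection with hz
  have hzA : z ∈ A := starProjection_supportSpace_mem hu.initial_mem
  have hcomm : ∀ a ∈ A, a * z = z * a :=
    mem_commutant_iff.1 starProjection_supportSpace_mem_commutant
  have hzz : z * z = z := isStarProjection_starProjection.isIdempotentElem
  have hzs : star z = z := isStarProjection_starProjection.isSelfAdjoint
  have hzp : z * p = p := starProjection_supportSpace_mul
  have hzu : ∀ n, z * u n = u n := fun n => by
    rw [← hu.mul_initial n, ← mul_assoc, ← hcomm _ (hu.mem n), mul_assoc, ← hp, hzp]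
  have huz : ∀ n, u n * z = u n := fun n => by rw [hcomm _ (hu.mem n), hzu]
  -- Keep `u` on the central summand `z` and use `v` only on `1 - z`. The two pieces live in
  -- complementary summands, so cross terms vanish and the new initial projection is `p + (1 - z) *
  -- q`.
  have hysy : ∀ m n, star ((1 - z) * v m) * ((1 - z) * v n) = (1 - z) * (star (v m) * v n) := by
    intro m n
    have h1 : star (v m) * z = z * star (v m) := hcomm _ (star_mem (hv.mem m))
    have h2 : (1 - z) * (1 - z) = 1 - z := by
      rw [sub_mul, one_mul, mul_sub, hzz, mul_one, sub_self, sub_zero]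
    calc star ((1 - z) * v m) * ((1 - z) * v n)
        = star (v m) * ((1 - z) * (1 - z)) * v n := by
          rw [star_mul, star_sub, star_one, hzs]; noncomm_ring
      _ = (1 - z) * (star (v m) * v n) := by
          rw [h2, mul_sub, mul_one, h1]; noncomm_ring
  have hcross : ∀ m n, star (u m) * ((1 - z) * v n) = 0 := by
    intro m n
    have : star (u m) * z = star (u m) := by
      have := congrArg star (hzu m)
      rwa [star_mul, hzs] at this
    rw [← mul_assoc, mul_sub, this, mul_one, sub_self, zero_mul]
  have hcross' : ∀ m n, star ((1 - z) * v m) * u n = 0 := by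
    intro m n
    have := congrArg star (hcross n m)
    rwa [star_mul, star_star, star_zero] at this
  have hww : ∀ m n, star (u m + (1 - z) * v m) * (u n + (1 - z) * v n)
      = star (u m) * u n + (1 - z) * (star (v m) * v n) := by
    intro m n
    rw [star_add, add_mul, mul_add, mul_add, hcross, hcross', hysy, add_zero, zero_add]
  have hself : ∀ n, star (u n + (1 - z) * v n) * (u n + (1 - z) * v n) = p + (1 - z) * q := by
    intro n
    rw [hww, hu.star_mul_self, hv.star_mul_self]
  have hup : ∀ n, u n * p = u n := hu.mul_initial
  have hvq : ∀ n, v n * q = v n := hv.mul_initial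
  have hvz : ∀ n, v n * z = z * v n := fun n => hcomm _ (hv.mem n)
  have hzr : z * (p + (1 - z) * q) = p := by
    rw [mul_add, hzp, ← mul_assoc, mul_sub, mul_one, hzz, sub_self, zero_mul, add_zero]
  have hzr' : (1 - z) * (p + (1 - z) * q) = (1 - z) * q := by
    rw [sub_mul, hzr, one_mul, add_sub_cancel_left]
  refine ⟨fun n => u n + (1 - z) * v n, ⟨?_, ?_, ?_, ?_, ?_⟩, ?_⟩
  · exact fun n => add_mem (hu.mem n) (mul_mem (sub_mem (one_mem A) hzA) (hv.mem n))
  · intro n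
    have : (1 - z) * v n = v n * (1 - z) := by rw [mul_sub, hvz, sub_mul]; simp
    rw [mul_add, hu.left_mul, this, ← mul_assoc, hv.left_mul]
  · intro m n hmn
    rw [hww, hu.orthogonal m n hmn, hv.orthogonal m n hmn, mul_zero, add_zero]
  · intro n
    rw [hself, hself]
  · intro n
    rw [hself]
    have h1 : u n * ((1 - z) * q) = 0 := by
      rw [← mul_assoc, mul_sub, mul_one, huz, sub_self, zero_mul]
    have h2 : (1 - z) * v n * (p + (1 - z) * q) = (1 - z) * v n := by
      have h3 : (1 - z) * v n = v n * (1 - z) := by rw [mul_sub, hvz, sub_mul]; simp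
      rw [h3, mul_assoc, hzr', ← mul_assoc, ← h3, mul_assoc, hvq]
    rw [add_mul, h2, mul_add, hup, h1, add_zero]
  · dsimp only
    rw [hself]
    have hple : A.supportSpace p ≤ A.supportSpace (p + (1 - z) * q) := by
      refine supportSpace_le isClosed_supportSpace fun a ha x => ?_
      have := apply_apply_mem_supportSpace (p := p + (1 - z) * q) (mul_mem ha hzA) x
      rwa [← mul_apply_eq_comp, mul_assoc, hzr] at this
    refine ⟨hple, supportSpace_le isClosed_supportSpace fun a ha x => ?_⟩
    have h1 : z (a (q x)) ∈ A.supportSpace (p + (1 - z) * q) :=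
      hple (Submodule.starProjection_apply_mem _ _)
    have h2 : ((1 - z) * a) ((p + (1 - z) * q) x) ∈ A.supportSpace (p + (1 - z) * q) :=
      apply_apply_mem_supportSpace (mul_mem (sub_mem (one_mem A) hzA) ha) x
    have h3 : (1 - z) * a = a * (1 - z) := by rw [mul_sub, hcomm a ha, sub_mul]; simp
    have h4 : ((1 - z) * a) ((p + (1 - z) * q) x) = a (q x) - z (a (q x)) := by
      have : (1 - z) * a * (p + (1 - z) * q) = (1 - z) * (a * q) := by
        rw [h3, mul_assoc, hzr', ← mul_assoc, ← h3, mul_assoc]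
      exact DFunLike.congr_fun this x
    rw [h4] at h2
    simpa using add_mem h2 h1

/-- In a type III algebra, if `e` has central support one, then every vector is approximated by
elements of `A p H`, for projections `p` having infinitely many orthogonal copies under `e`. -/
theorem IsTypeIII.exists_orthogonalCopies_norm_sub_lt {A : VonNeumannAlgebra H}
    (hA : A.IsTypeIII) {e : H →L[ℂ] H} (he : e ∈ A) (hp : IsStarProjection e)
    (htop : A.supportSpace e = ⊤) (η : H) {ε : ℝ} (hε : 0 < ε) :
    ∃ u, A.OrthogonalCopies e u ∧
      ∃ y ∈ Submodule.span ℂ {y | ∃ a ∈ A, ∃ x, a ((star (u 0) * u 0) x) = y}, ‖η - y‖ < ε := by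
  let I := {u // A.OrthogonalCopies e u}
  let S : I → Submodule ℂ H := fun u => A.supportSpace (star (u.1 0) * u.1 0)
  have : Nonempty I := ⟨⟨_, OrthogonalCopies.zero A e⟩⟩
  -- Directedness makes the supremum a union, so an approximant of `η` lies in the support space of
  -- a single sequence of copies.
  have hdir : Directed (· ≤ ·) S := by
    rintro ⟨u, hu⟩ ⟨v, hv⟩
    obtain ⟨w, hw, h1, h2⟩ := hu.exists_supportSpace_le hv
    exact ⟨⟨w, hw⟩, h1, h2⟩
  set K := (⨆ u, S u).topologicalClosure with hK
  have hinv : ∀ b : H →L[ℂ] H, (∀ u, ∀ x ∈ S u, b x ∈ S u) → ∀ x ∈ K, b x ∈ K := by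
    intro b hb x hx
    refine b.apply_mem_topologicalClosure (fun y hy => ?_) hx
    obtain ⟨i, hi⟩ := (Submodule.mem_iSup_of_directed S hdir).1 hy
    exact (Submodule.mem_iSup_of_directed S hdir).2 ⟨i, hb i y hi⟩
  set z := K.starProjection with hz
  have hzA : z ∈ A := A.starProjection_mem _ fun b hb =>
    hinv b fun u x hx => mem_supportSpace_of_mem_commutant u.2.initial_mem hb hx
  have hzA' : z ∈ A.commutant := A.commutant.starProjection_mem _ fun b hb =>
    hinv b fun u x hx => mem_supportSpace_of_mem (by simpa using hb) hx
  have hcomm : ∀ a ∈ A, a * z = z * a := mem_commutant_iff.1 hzA'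
  have hzp : IsStarProjection z := isStarProjection_starProjection
  -- Otherwise `(1 - z) * e` contains copies of a nonzero projection. Its support space is one of
  -- the `S u`, hence under `z`, while centrality of `z` and `z * u 0 = 0` force it to vanish.
  have hze : (1 - z) * e = 0 := by
    by_contra hne
    have hc : Commute (1 - z) e := by
      change (1 - z) * e = e * (1 - z)
      rw [mul_sub, hcomm e he, sub_mul]; simp
    have hq : IsStarProjection ((1 - z) * e) :=
      ⟨IsIdempotentElem.mul_of_commute hc hzp.one_sub.isIdempotentElem hp.isIdempotentElem, by
        rw [IsSelfAdjoint, star_mul, hp.isSelfAdjoint.star_eq,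
          hzp.one_sub.isSelfAdjoint.star_eq, hc.eq]⟩
    obtain ⟨u, hu, hu0⟩ :=
      hA.exists_orthogonalCopies (mul_mem (sub_mem (one_mem A) hzA) he) hq hne
    have hue : A.OrthogonalCopies e u := hu.mono (by
      rw [hc.eq, ← mul_assoc, hp.isIdempotentElem.eq])
    have hzu : z * u 0 = 0 := by
      rw [← hu.left_mul 0, ← mul_assoc, ← mul_assoc, hzp.mul_one_sub_self, zero_mul, zero_mul]
    have hzi : z * (star (u 0) * u 0) = star (u 0) * u 0 := by
      ext x
      refine Submodule.starProjection_eq_self_iff.2 (Submodule.le_topologicalClosure _ ?_)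
      exact (le_iSup S ⟨u, hue⟩) (apply_mem_supportSpace x)
    apply hu0
    rw [← CStarRing.star_mul_self_eq_zero_iff, ← hzi, ← mul_assoc,
      ← hcomm _ (star_mem (hu.mem 0)), mul_assoc, hzu, mul_zero]
  have hzη : z η = η := by
    have hle : A.supportSpace e ≤ K := by
      refine supportSpace_le (Submodule.isClosed_topologicalClosure _) fun a ha x => ?_
      have h1 : z * e = e := by
        rw [sub_mul, one_mul, sub_eq_zero] at hze; exact hze.symm
      have h2 : z * (a * e) = a * e := by
        rw [← mul_assoc, ← hcomm a ha, mul_assoc, h1]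
      exact Submodule.starProjection_eq_self_iff.1 (DFunLike.congr_fun h2 x)
    exact Submodule.starProjection_eq_self_iff.2 (hle (htop ▸ Submodule.mem_top))
  have hηK : η ∈ K := Submodule.starProjection_eq_self_iff.1 hzη
  obtain ⟨κ, hκ, hd⟩ := Metric.mem_closure_iff.1 hηK (ε / 2) (half_pos hε)
  obtain ⟨⟨u, hu⟩, hκu⟩ := (Submodule.mem_iSup_of_directed S hdir).1 hκ
  obtain ⟨y, hy, hd'⟩ := Metric.mem_closure_iff.1 hκu (ε / 2) (half_pos hε)
  refine ⟨u, hu, y, hy, ?_⟩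
  rw [← dist_eq_norm]
  linarith [dist_triangle η κ y]

/-- The perturbation lemma: a small corner `g` of `A` under `e`, an element `b` supported on it and
a vector `v` in its range such that `b v` is near `η`, while `g ζ` and `b ζ` are small. -/
theorem IsTypeIII.exists_corner {A : VonNeumannAlgebra H}
    (hA : A.IsTypeIII) {e : H →L[ℂ] H} (he : e ∈ A) (hp : IsStarProjection e)
    (htop : A.supportSpace e = ⊤) (η ζ : H) {ε δ : ℝ} (hε : 0 < ε) (hδ : 0 < δ) :
    ∃ g ∈ A, ∃ b ∈ A, ∃ v, g v = v ∧ b * g = b ∧ e v = v ∧ ‖η - b v‖ < ε ∧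
      ‖g ζ‖ < δ ∧ ‖b ζ‖ < δ := by
  obtain ⟨u, hu, y, hy, hηy⟩ := hA.exists_orthogonalCopies_norm_sub_lt he hp htop η hε
  obtain ⟨k, c, s, hs⟩ := Submodule.mem_span_set'.1 hy
  choose a ha x hx using fun i => (s i).2
  -- Each of the `k` terms of `y` gets its own copy `u (N + i)`, so orthogonality lets `b N` apply
  -- `a i` to the `i`-th term alone; `N → ∞` makes `ζ` negligible there.
  let g : ℕ → H →L[ℂ] H := fun N => ∑ i : Fin k, u (N + i) * star (u (N + i))
  let b : ℕ → H →L[ℂ] H := fun N => ∑ i : Fin k, a i * star (u (N + i))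
  have htail : ∀ i : Fin k, Tendsto (fun N => star (u (N + i)) ζ) atTop (𝓝 0) := fun i =>
    (hu.tendsto_star_apply ζ).comp (tendsto_add_atTop_nat i)
  have hb : Tendsto (fun N => b N ζ) atTop (𝓝 0) := by
    have : ∀ i : Fin k, Tendsto (fun N => a i (star (u (N + i)) ζ)) atTop (𝓝 0) := fun i => by
      rw [← map_zero (a i)]
      exact ((a i).continuous.tendsto 0).comp (htail i)
    simpa [b, sum_apply] using
      tendsto_finsetSum Finset.univ fun i _ => this i
  have hg : Tendsto (fun N => g N ζ) atTop (𝓝 0) := by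
    have : ∀ i : Fin k, Tendsto (fun N => u (N + i) (star (u (N + i)) ζ)) atTop (𝓝 0) := fun i =>
      squeeze_zero_norm (fun N => by
        simpa using ContinuousLinearMap.le_of_opNorm_le _ (hu.norm_le_one (N + i)) (star (u (N + i)) ζ))
        (by simpa using (htail i).norm)
    simpa [g, sum_apply] using
      tendsto_finsetSum Finset.univ fun i _ => this i
  obtain ⟨N, hgN, hbN⟩ := ((Metric.tendsto_nhds.1 hg δ hδ).and (Metric.tendsto_nhds.1 hb δ hδ)).exists
  rw [dist_zero_right] at hgN hbN
  have hgA : g N ∈ A :=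
    sum_mem fun i _ => mul_mem (hu.mem _) (star_mem (hu.mem _))
  have hbA : b N ∈ A := sum_mem fun i _ => mul_mem (ha i) (star_mem (hu.mem _))
  have hne : ∀ i j : Fin k, i ≠ j → N + (i : ℕ) ≠ N + (j : ℕ) := fun i j hij h =>
    hij (Fin.ext (Nat.add_left_cancel h))
  have hpu : ∀ n, star (u 0) * u 0 * star (u n) = star (u n) := fun n => by
    have := congrArg star (hu.mul_initial n)
    simpa [star_mul, mul_assoc] using this
  have hstarg : ∀ i : Fin k, star (u (N + i)) * g N = star (u (N + i)) := by
    intro i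
    simp only [g, Finset.mul_sum]
    rw [Finset.sum_eq_single i, ← mul_assoc, hu.star_mul_self, hpu]
    · intro j _ hj
      rw [← mul_assoc, hu.orthogonal _ _ (hne i j hj.symm), zero_mul]
    · simp
  have hgu : ∀ i : Fin k, g N * u (N + i) = u (N + i) := by
    intro i
    simp only [g, Finset.sum_mul]
    rw [Finset.sum_eq_single i, mul_assoc, hu.star_mul_self, hu.mul_initial]
    · intro j _ hj
      rw [mul_assoc, hu.orthogonal _ _ (hne j i hj), mul_zero]
    · simp
  refine ⟨g N, hgA, b N, hbA, ∑ i : Fin k, u (N + i) (c i • x i), ?_, ?_, ?_, ?_, hgN, hbN⟩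
  · rw [map_sum]
    exact Finset.sum_congr rfl fun i _ => DFunLike.congr_fun (hgu i) _
  · simp only [b, Finset.sum_mul]
    exact Finset.sum_congr rfl fun i _ => by rw [mul_assoc, hstarg]
  · rw [map_sum]
    exact Finset.sum_congr rfl fun i _ => DFunLike.congr_fun (hu.left_mul _) _
  · have : b N (∑ i : Fin k, u (N + i) (c i • x i)) = y := by
      rw [← hs, map_sum]
      refine Finset.sum_congr rfl fun i _ => ?_
      simp only [b, sum_apply, mul_apply_eq_comp]
      rw [Finset.sum_eq_single i]
      · rw [hu.star_mul_apply, if_pos rfl, map_smul, map_smul, hx]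
      · intro j _ hj
        rw [hu.star_mul_apply, if_neg (hne j i hj), map_zero]
      · simp
    rwa [this]

/-! ### Density -/

theorem IsTypeIII.dense_isCyclicVector [TopologicalSpace.SeparableSpace H]
    {A : VonNeumannAlgebra H} (hA : A.IsTypeIII) : Dense {ξ | A.IsCyclicVector ξ} := by
  refine A.dense_setOf_isCyclicVector fun η ε hε => Metric.dense_iff.2 fun ζ r hr => ?_
  have htop : A.supportSpace 1 = ⊤ :=
    eq_top_iff.2 fun x _ => apply_mem_supportSpace (p := 1) x
  obtain ⟨g, hg, b, hb, v, hgv, hbg, -, hη, hgζ, -⟩ :=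
    hA.exists_corner (one_mem A) (.one _) htop η ζ hε (half_pos hr)
  obtain ⟨t, ht0, ht⟩ : ∃ t : ℝ, 0 < t ∧ t * ‖v‖ < r / 2 := by
    refine ⟨r / 2 / (‖v‖ + 1), by positivity, ?_⟩
    rw [div_mul_eq_mul_div, div_lt_iff₀ (by positivity)]
    nlinarith [norm_nonneg v]
  -- Since `b * g = b`, `b` kills `ζ - g ζ`. The factor `t⁻¹` is harmless because nothing bounds the
  -- norm of the algebra element.
  refine ⟨ζ - g ζ + (t : ℂ) • v, ?_, (t : ℂ)⁻¹ • b, smul_mem' _ hb, ?_⟩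
  · rw [Metric.mem_ball, dist_eq_norm]
    calc ‖ζ - g ζ + (t : ℂ) • v - ζ‖ = ‖(t : ℂ) • v - g ζ‖ := by congr 1; abel
      _ ≤ ‖(t : ℂ) • v‖ + ‖g ζ‖ := norm_sub_le _ _
      _ = t * ‖v‖ + ‖g ζ‖ := by rw [norm_smul, Complex.norm_real, Real.norm_of_nonneg ht0.le]
      _ < r := by linarith
  · have h1 : b (g ζ) = b ζ := DFunLike.congr_fun hbg ζ
    have h2 : ((t : ℂ)⁻¹ • b) (ζ - g ζ + (t : ℂ) • v) = b v := by
      have : (t : ℂ) ≠ 0 := by exact_mod_cast ht0.ne'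
      rw [smul_apply, map_add, map_sub, map_smul, h1, sub_self, zero_add, smul_smul,
        inv_mul_cancel₀ this, one_smul]
    rw [h2, norm_sub_rev]
    exact hη

theorem IsTypeIII.dense_isCyclicVector_commutant [TopologicalSpace.SeparableSpace H]
    {A : VonNeumannAlgebra H} (hA : A.IsTypeIII) : Dense {ξ | A.commutant.IsCyclicVector ξ} := by
  refine A.commutant.dense_setOf_isCyclicVector fun η ε hε => Metric.dense_iff.2 fun ζ' r hr => ?_
  -- Starting from a vector cyclic for `A` gives the projection onto the closure of `A' ζ` central
  -- support one.
  obtain ⟨ζ, hζd, hζ⟩ := Metric.dense_iff.1 hA.dense_isCyclicVector ζ' (r / 2) (half_pos hr)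
  set K := (A.commutant.orbit ζ).topologicalClosure with hK
  have heA : K.starProjection ∈ A := starProjection_closure_orbit_mem A ζ
  have hζK : K.starProjection ζ = ζ := Submodule.starProjection_eq_self_iff.2
    (Submodule.le_topologicalClosure _ (self_mem_orbit _ _))
  have htop : A.supportSpace K.starProjection = ⊤ := by
    refine eq_top_iff.2 fun x _ => ?_
    refine closure_minimal ?_ isClosed_supportSpace (hζ x)
    rintro _ ⟨a, ha, rfl⟩
    have := apply_apply_mem_supportSpace (p := K.starProjection) ha ζ
    rwa [hζK] at this
  obtain ⟨g, hg, b, hb, v, hgv, -, hev, hη, hgζ, hbζ⟩ :=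
    hA.exists_corner heA isStarProjection_starProjection htop η ζ (half_pos hε)
      (show 0 < r / 4 by positivity)
  set w : H →L[ℂ] H := 1 - g + b with hw
  have hwA : w ∈ A := add_mem (sub_mem (one_mem A) hg) hb
  have hwv : w v = b v := by simp [hw, hgv]
  have hvK : v ∈ K := Submodule.starProjection_eq_self_iff.1 hev
  refine ⟨w ζ, ?_, ?_⟩
  · rw [Metric.mem_ball] at hζd ⊢
    have : dist (w ζ) ζ < r / 2 := by
      rw [dist_eq_norm]
      calc ‖w ζ - ζ‖ = ‖b ζ - g ζ‖ := by
            congr 1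
            simp only [hw, add_apply, sub_apply,
              one_apply_eq_self]
            abel
        _ ≤ ‖b ζ‖ + ‖g ζ‖ := norm_sub_le _ _
        _ < r / 2 := by linarith
    linarith [dist_triangle (w ζ) ζ ζ']
  -- Because `w` commutes with `A'`, `w` maps `A' ζ` onto `A' (w ζ)`; as `v` is in the closure of
  -- the former, `w v = b v` is in that of the latter.
  · have hmem : w v ∈ closure (w '' (A.commutant.orbit ζ : Set H)) :=
      image_closure_subset_closure_image w.continuous ⟨v, hvK, rfl⟩
    obtain ⟨_, ⟨_, ⟨a, ha, rfl⟩, rfl⟩, hd⟩ := Metric.mem_closure_iff.1 hmem (ε / 2) (half_pos hε)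
    refine ⟨a, ha, ?_⟩
    rw [apply_comm_of_mem_commutant hwA ha, hwv, dist_eq_norm, norm_sub_rev] at hd
    rw [norm_sub_rev] at hη
    calc ‖a (w ζ) - η‖ = ‖(a (w ζ) - b v) + (b v - η)‖ := by congr 1; abel
      _ ≤ ‖a (w ζ) - b v‖ + ‖b v - η‖ := norm_add_le _ _
      _ < ε := by linarith

theorem cyclicSeparatingVectors_eq (A : VonNeumannAlgebra H) :
    A.cyclicSeparatingVectors = {ξ | A.IsCyclicVector ξ} ∩ {ξ | A.commutant.IsCyclicVector ξ} := by
  ext ξ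
  exact and_congr Iff.rfl (A.isSeparatingVector_iff ξ)

theorem isGδ_cyclicSeparatingVectors [TopologicalSpace.SeparableSpace H]
    (A : VonNeumannAlgebra H) : IsGδ A.cyclicSeparatingVectors := by
  rw [cyclicSeparatingVectors_eq]
  exact A.isGδ_setOf_isCyclicVector.inter A.commutant.isGδ_setOf_isCyclicVector

theorem IsTypeIII.dense_cyclicSeparatingVectors [TopologicalSpace.SeparableSpace H]
    {A : VonNeumannAlgebra H} (hA : A.IsTypeIII) : Dense A.cyclicSeparatingVectors := by
  rw [cyclicSeparatingVectors_eq]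
  exact Dense.inter_of_Gδ A.isGδ_setOf_isCyclicVector A.commutant.isGδ_setOf_isCyclicVector
    hA.dense_isCyclicVector hA.dense_isCyclicVector_commutant

end VonNeumannAlgebra

theorem mainTheorem8 {H : Type*} [NormedAddCommGroup H] [InnerProductSpace ℂ H]
    [CompleteSpace H] [TopologicalSpace.SeparableSpace H]
    (A B : VonNeumannAlgebra H) (hA : A.IsTypeIII) (hB : B.IsTypeIII) :
    Dense (A.cyclicSeparatingVectors ∩ B.cyclicSeparatingVectors) ∧
      IsGδ (A.cyclicSeparatingVectors ∩ B.cyclicSeparatingVectors) :=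
  ⟨Dense.inter_of_Gδ A.isGδ_cyclicSeparatingVectors B.isGδ_cyclicSeparatingVectors
      hA.dense_cyclicSeparatingVectors hB.dense_cyclicSeparatingVectors,
    A.isGδ_cyclicSeparatingVectors.inter B.isGδ_cyclicSeparatingVectors⟩
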